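/- Let $f=\sum_{i=0}^n f_i(x)y^i\in\mathbb{C}[x,y]$ with $f_i\in\mathbb{C}[x]$, where $f_0$ and $f_n$ are nonzero (so $n=\deg_y f$), and let $m=\deg_x f$. Suppose that $f$ is reduced, i.e. no irreducible factor of $f$ in $\mathbb{C}[x,y]$ appears multiple times. Write $f=\sum_{i,j}a_{ij}x^iy^j$ with $a_{ij}\in\mathbb{C}$. The multi-homogenization of $f$ is $$\hat f=\sum_{i,j}a_{ij}\,x^i\tilde x^{\,m-i}y^j\tilde y^{\,n-j}\in\mathbb{C}[x,\tilde x,y,\tilde y],$$ and $\hat f_y$ denotes its partial derivative with respect to $y$. Let $\mathrm{Disc}_y(f)\in\mathbb{C}[x]$ be the discriminant of $f$ with respect to $y$: for $n\ge 1$ it is the polynomial such that $$\mathrm{Disc}_y(f)(a)=f_n(a)^{2n-2}\prod_{1\le i<j\le n}(b_i-b_j)^2$$ for every $a\in\mathbb{C}$ with $f_n(a)\neq 0$, where $b_1,\dots,b_n$ are the roots of $f(a,y)$ counted with multiplicity (so it is $1$ if $n=1$); for $n=0$ put $\mathrm{Disc}_y(f)=1$. Then the following three conditions are equivalent: (A)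 $f$ is quasi-homogeneous with nonzero weight on $x$: there are integers $w,\alpha,\beta$ with $\alpha\neq 0$ such that $w=\alpha i+\beta j$ for all $(i,j)$ with $a_{ij}\neq 0$. (B) $f_0$, $f_n$ and $\mathrm{Disc}_y(f)$ are nonzero monomials in $x$, i.e. each is of the form $cx^k$ with $c\in\mathbb{C}\setminus\{0\}$ and $k\ge 0$. (C) The subvarieties of $\mathbb{P}^1\times\mathbb{P}^1$ (with homogeneous coordinates $[x:\tilde x]$ and $[y:\tilde y]$) defined by $\hat f$ and $y\hat f_y$ have no common point in $\mathbb{C}^\times\times\mathbb{P}^1$, where $\mathbb{C}^\times=\{[a:1] : a\in\mathbb{C},\ a\ne 0\}\subset\mathbb{P}^1$ and $\mathbb{P}^1=\mathbb{P}^1(\mathbb{C})$. -/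

import Mathlib

open scoped LinearAlgebra.Projectivization

/-- `C[x, y]`, written as `C[x][y]`: for `f : BivariatePoly`, the polynomial `f.coeff j` is the
coefficient `f_j ∈ C[x]` of `y ^ j`, and `(f.coeff j).coeff i` is the coefficient of
`x ^ i * y ^ j`. -/
abbrev BivariatePoly : Type := Polynomial (Polynomial ℂ)

namespace BivariatePoly

/-- `f` is quasi-homogeneous of type `(w; α, β)`: the integers `α, β` are not both zero, and
`w = α * i + β * j` for every monomial `x ^ i * y ^ j` that occurs in `f`. -/
def IsQuasiHomogeneousOfType (f : BivariatePoly) (w α β : ℤ) : Prop :=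
  (α ≠ 0 ∨ β ≠ 0) ∧
    ∀ i j : ℕ, (f.coeff j).coeff i ≠ 0 → w = α * (i : ℤ) + β * (j : ℤ)

/-- The degree of `f` in the variable `x`. -/
noncomputable def xDegree (f : BivariatePoly) : ℕ :=
  f.support.sup fun j => (f.coeff j).natDegree

/-- The degree of `f` in the variable `y`. -/
noncomputable def yDegree (f : BivariatePoly) : ℕ :=
  f.natDegree

/-- The discriminant of `f` with respect to `y`, an element of `C[x]`. It equals `1` if
the degree of `f` in `y` is at most one. -/
noncomputable def discY (f : BivariatePoly) : Polynomial ℂ :=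
  Polynomial.discr f

/-- The ring `C[x, x', y, y']`; the variables `x, x', y, y'` are numbered `0, 1, 2, 3`. -/
abbrev BihomogPoly : Type := MvPolynomial (Fin 4) ℂ

/-- The multi-homogenization `∑ a_ij * x ^ i * x' ^ (m - i) * y ^ j * y' ^ (n - j)` of
`f = ∑ a_ij * x ^ i * y ^ j`, where `m` and `n` are the degrees of `f` in `x` and in `y`. -/
noncomputable def multiHomogenization (f : BivariatePoly) : BihomogPoly :=
  ∑ j ∈ Finset.range (f.yDegree + 1), ∑ i ∈ Finset.range (f.xDegree + 1),
    MvPolynomial.C ((f.coeff j).coeff i) *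
      (MvPolynomial.X 0 ^ i * MvPolynomial.X 1 ^ (f.xDegree - i) *
        (MvPolynomial.X 2 ^ j * MvPolynomial.X 3 ^ (f.yDegree - j)))

end BivariatePoly

/-- A polynomial in one variable of the form `c * x ^ k` with `c ≠ 0`. -/
def IsNonzeroMonomial (p : Polynomial ℂ) : Prop :=
  ∃ (k : ℕ) (c : ℂ), c ≠ 0 ∧ p = Polynomial.monomial k c

/-- The complex projective line. -/
abbrev ProjLine : Type := ℙ ℂ (Fin 2 → ℂ)

namespace ProjLine

/-- The subset `C \ {0}` of the projective line, `a` being identified with `[a : 1]`. -/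
def puncturedLine : Set ProjLine :=
  {P | ∃ a : ℂ, a ≠ 0 ∧ ∃ h : (![a, 1] : Fin 2 → ℂ) ≠ 0, P = Projectivization.mk ℂ ![a, 1] h}

/-- The points `([x : x'], [y : y'])` of `P^1 × P^1` at which `F` vanishes, that is, at which
`F (x, x', y, y') = 0` for all homogeneous coordinates of the two components. (When `F` is
multi-homogeneous, one choice of the coordinates gives the same as all choices.) -/
def zeroLocus (F : MvPolynomial (Fin 4) ℂ) : Set (ProjLine × ProjLine) :=
  {p | ∀ (u v : Fin 2 → ℂ) (hu : u ≠ 0) (hv : v ≠ 0),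
    Projectivization.mk ℂ u hu = p.1 → Projectivization.mk ℂ v hv = p.2 →
      MvPolynomial.eval ![u 0, u 1, v 0, v 1] F = 0}

end ProjLine

/-!
All three conditions are equivalent to the following: for every `a ≠ 0` the fibre `f(a, y) = 0` is
nondegenerate, that is, `f_n(a)` and `f_0(a)` are nonzero and `f(a, y)` has only simple roots
(`BivariatePoly.IsNondegenerateAt`).

* For the monomial condition, a polynomial is a nonzero monomial if and only if it has no root in
  `ℂˣ` (`isNonzeroMonomial_iff_eval_ne_zero`), and where `f_n` does not vanish the discriminant
  detects multiple roots (`BivariatePoly.eval_discY_ne_zero_iff`).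
* For the condition on `ℙ¹ × ℙ¹`, the common zeros of `f̂` and `y f̂_y` over `a` are the points
  `y = ∞` if `f_n(a) = 0`, `y = 0` if `f_0(a) = 0`, and the multiple roots
  (`BivariatePoly.zeroLocus_inter_eq_empty_iff`).
* If `f` is quasi-homogeneous, then nondegeneracy is invariant under the torus action
  `(x, y) ↦ (t ^ α x, t ^ β y)`, which is transitive on `x ∈ ℂˣ` for `α ≠ 0`. As `f` is squarefree,
  its discriminant is not the zero polynomial by Gauss's lemma, so some fibre is nondegenerate, and
  hence all of them are.

The converse uses complex analysis. If all fibres over `ℂˣ` are nondegenerate, then the roots of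
`f(exp z, y)` form a finite covering of the `z`-plane (`isCoveringMap_rootProj`). The plane being
simply connected, the roots are given by entire functions `Y_b`, indexed by the roots `b` of
`f(1, y)`, whose values never coincide and are never `0`. They have exponential growth because `f_n`
is a monomial, so `Y_b(z) = b exp(a_b z)` by the Borel–Carathéodory theorem
(`exists_eq_mul_exp_of_norm_le`). Two functions `b exp(a_b z)` and `b' exp(a_b' z)` with
`a_b ≠ a_b'` have a common value, so all `a_b` are equal to one number `a`. Therefore
`f_j(exp z) = f_j(1) exp((k + a (n - j)) z)`, where `f_n = c x ^ k`. Thus every monomial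
`x ^ i y ^ j` of `f` satisfies `i = k + a (n - j)`, and the value `i = l` at `j = 0` shows that
`n a = l - k` is an integer.
-/

open Polynomial

/-! ### Monomials and squarefree polynomials -/

/-- Over `ℂ`, the nonzero monomials are the polynomials without roots in `ℂˣ`. -/
theorem isNonzeroMonomial_iff_eval_ne_zero {p : ℂ[X]} :
    IsNonzeroMonomial p ↔ ∀ a : ℂ, a ≠ 0 → p.eval a ≠ 0 := by
  constructor
  · rintro ⟨k, c, hc, rfl⟩ a ha
    simp [eval_monomial, hc, ha]
  · intro h
    have hp : p ≠ 0 := by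
      rintro rfl
      exact h 1 one_ne_zero (by simp)
    obtain ⟨q, hq, hndvd⟩ := exists_eq_pow_rootMultiplicity_mul_and_not_dvd p hp 0
    have hq0 : q.eval 0 ≠ 0 := fun h0 ↦ hndvd (dvd_iff_isRoot.mpr h0)
    have hdeg : q.degree = 0 := by
      by_contra hd
      obtain ⟨a, ha⟩ := IsAlgClosed.exists_root q hd
      by_cases ha0 : a = 0
      · exact hq0 (by rwa [IsRoot, ha0] at ha)
      · refine h a ha0 ?_
        rw [hq, eval_mul, ha.eq_zero, mul_zero]
    rw [eq_C_of_degree_eq_zero hdeg] at hq hq0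
    refine ⟨p.rootMultiplicity 0, q.coeff 0, by simpa using hq0, ?_⟩
    rw [← C_mul_X_pow_eq_monomial, mul_comm]
    simpa using hq

/-- By Gauss's lemma, a squarefree polynomial stays squarefree over the field of fractions. -/
theorem Squarefree.map_fractionRing {R K : Type*} [CommRing R] [IsDomain R]
    [NormalizedGCDMonoid R] [Field K] [Algebra R K] [IsFractionRing R K] {f : R[X]}
    (hf : Squarefree f) (hf0 : f ≠ 0) : Squarefree (f.map (algebraMap R K)) := by
  have hinj : Function.Injective (algebraMap R K) := IsFractionRing.injective R K
  have hmap0 : f.map (algebraMap R K) ≠ 0 := (Polynomial.map_ne_zero_iff hinj).mpr hf0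
  rw [squarefree_iff_irreducible_sq_not_dvd_of_ne_zero hmap0]
  intro g hg hdvd
  set h := IsLocalization.integerNormalization (nonZeroDivisors R) g with hh
  obtain ⟨b, hb, hmap⟩ := IsLocalization.integerNormalization_spec (nonZeroDivisors R) g
  -- the primitive part of a multiple of `g` with coefficients in `R` divides `g`
  have hprim : h.primPart.map (algebraMap R K) ∣ g := by
    have h1 : h.primPart.map (algebraMap R K) ∣ C (algebraMap R K b) * g := by
      have h2 : C (algebraMap R K b) * g = h.map (algebraMap R K) := by
        rw [hh, hmap, Algebra.smul_def, Polynomial.algebraMap_apply]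
      rw [h2, h.eq_C_content_mul_primPart, Polynomial.map_mul,
        ← h.eq_C_content_mul_primPart]
      exact dvd_mul_left _ _
    have hu : IsUnit (C (algebraMap R K b)) := by
      refine isUnit_C.mpr (isUnit_iff_ne_zero.mpr fun h0 ↦ nonZeroDivisors.ne_zero hb ?_)
      exact hinj (by rw [h0, map_zero])
    exact (hu.dvd_mul_left).mp h1
  have hsq : h.primPart * h.primPart ∣ f := by
    refine ((h.isPrimitive_primPart).mul h.isPrimitive_primPart
      |>.dvd_of_fraction_map_dvd_fraction_map (K := K)) ?_
    rw [Polynomial.map_mul]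
    exact (mul_dvd_mul hprim hprim).trans hdvd
  exact hg.not_isUnit
    (isUnit_or_eq_zero_of_isUnit_integerNormalization_primPart hg.ne_zero (hf _ hsq))

namespace BivariatePoly

/-! ### Fibres and the discriminant -/

/-- The polynomial `f(a, y)` in the variable `y`. -/
noncomputable def fiber (f : BivariatePoly) (a : ℂ) : ℂ[X] := f.map (evalRingHom a)

@[simp]
theorem coeff_fiber (f : BivariatePoly) (a : ℂ) (j : ℕ) :
    (f.fiber a).coeff j = (f.coeff j).eval a := by
  simp [fiber]

theorem natDegree_fiber {f : BivariatePoly} {a : ℂ} (h : (f.coeff f.natDegree).eval a ≠ 0) :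
    (f.fiber a).natDegree = f.natDegree :=
  natDegree_map_of_leadingCoeff_ne_zero _ h

/-- The fibre of the curve `f = 0` over `a` consists of `deg_y f` distinct nonzero points of the
affine line: neither `0` nor `∞` nor a multiple root occurs. -/
def IsNondegenerateAt (f : BivariatePoly) (a : ℂ) : Prop :=
  (f.coeff f.natDegree).eval a ≠ 0 ∧ (f.coeff 0).eval a ≠ 0 ∧
    ∀ y, (f.fiber a).eval y = 0 → (f.fiber a).derivative.eval y ≠ 0

/-- Where the leading coefficient does not vanish, the discriminant detects multiple roots. -/
theorem eval_discY_ne_zero_iff {f : BivariatePoly} {a : ℂ}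
    (h : (f.coeff f.natDegree).eval a ≠ 0) :
    f.discY.eval a ≠ 0 ↔
      ∀ y, (f.fiber a).eval y = 0 → (f.fiber a).derivative.eval y ≠ 0 := by
  rcases Nat.eq_zero_or_pos f.natDegree with hn | hn
  · obtain ⟨c, rfl⟩ : ∃ c, f = C c := ⟨_, eq_C_of_natDegree_eq_zero hn⟩
    simp only [natDegree_C, coeff_C_zero] at h
    simp [discY, fiber, h]
  · have hdeg := natDegree_fiber h
    have hres : resultant (f.fiber a) (f.fiber a).derivative =
        (-1) ^ (f.natDegree * (f.natDegree - 1) / 2) * (f.coeff f.natDegree).eval a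
          * f.discY.eval a := by
      rw [natDegree_derivative, hdeg, fiber, derivative_map, resultant_map_map,
        resultant_deriv (natDegree_pos_iff_degree_pos.mp hn)]
      simp only [map_mul, map_pow, map_neg, map_one, coe_evalRingHom, discY, leadingCoeff]
    have hf0 : f.fiber a ≠ 0 := by
      intro h0
      rw [h0, natDegree_zero] at hdeg
      omega
    have h1 : f.discY.eval a ≠ 0 ↔ IsCoprime (f.fiber a) (f.fiber a).derivative := by
      rw [← not_iff_not, not_not]
      have := resultant_eq_zero_iff (f := f.fiber a) (g := (f.fiber a).derivative)
      rw [hres] at this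
      simpa only [mul_eq_zero, pow_eq_zero_iff', neg_eq_zero, one_ne_zero, false_and, false_or, h,
        ne_eq, hf0, not_false_eq_true, true_or, true_and] using this
    rw [h1, isCoprime_iff_aeval_ne_zero_of_isAlgClosed ℂ ℂ]
    simp only [coe_aeval_eq_eval]
    exact forall_congr' fun y ↦ by tauto

theorem isNondegenerateAt_iff {f : BivariatePoly} {a : ℂ} :
    f.IsNondegenerateAt a ↔ (f.coeff 0).eval a ≠ 0 ∧ (f.coeff f.natDegree).eval a ≠ 0 ∧
      f.discY.eval a ≠ 0 := by
  unfold IsNondegenerateAt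
  constructor
  · rintro ⟨h1, h2, h3⟩
    exact ⟨h2, h1, (eval_discY_ne_zero_iff h1).mpr h3⟩
  · rintro ⟨h2, h1, h3⟩
    exact ⟨h1, h2, (eval_discY_ne_zero_iff h1).mp h3⟩

theorem discY_ne_zero {f : BivariatePoly} (hf : Squarefree f) (hf0 : f ≠ 0) : f.discY ≠ 0 := by
  rcases Nat.eq_zero_or_pos f.natDegree with hn | hn
  · obtain ⟨c, rfl⟩ : ∃ c, f = C c := ⟨_, eq_C_of_natDegree_eq_zero hn⟩
    simp [discY]
  · intro h0
    classical
    let _ : NormalizedGCDMonoid ℂ[X] := Nonempty.some inferInstance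
    have hsep : (f.map (algebraMap ℂ[X] (FractionRing ℂ[X]))).Separable :=
      PerfectField.separable_iff_squarefree.mpr (hf.map_fractionRing hf0)
    have hres := resultant_deriv (natDegree_pos_iff_degree_pos.mp hn)
    rw [show f.discr = 0 from h0, mul_zero] at hres
    have hinj : Function.Injective (algebraMap ℂ[X] (FractionRing ℂ[X])) :=
      IsFractionRing.injective _ _
    refine resultant_ne_zero _ _ hsep ?_
    rw [natDegree_derivative, natDegree_map_eq_of_injective hinj, derivative_map,
      resultant_map_map, hres, map_zero]

/-! ### The torus action -/

theorem eval_fiber (f : BivariatePoly) (a y : ℂ) :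
    (f.fiber a).eval y = ∑ j ∈ Finset.range (f.natDegree + 1), (f.coeff j).eval a * y ^ j := by
  rw [eval_eq_sum_range' (Nat.lt_succ_of_le (show (f.fiber a).natDegree ≤ f.natDegree from
    natDegree_map_le))]
  simp

theorem mul_eval_derivative_fiber (f : BivariatePoly) (a y : ℂ) :
    y * (f.fiber a).derivative.eval y =
      ∑ j ∈ Finset.range (f.natDegree + 1), (f.coeff j).eval a * (j * y ^ j) := by
  have hlt : (X * (f.fiber a).derivative).natDegree < f.natDegree + 1 := by
    refine Nat.lt_succ_of_le (natDegree_le_iff_coeff_eq_zero.mpr fun N hN ↦ ?_)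
    obtain ⟨N, rfl⟩ : ∃ M, N = M + 1 := ⟨N - 1, by omega⟩
    rw [coeff_X_mul, coeff_derivative, coeff_fiber, coeff_eq_zero_of_natDegree_lt hN]
    simp
  have h := eval_eq_sum_range' hlt y
  rw [eval_mul, eval_X] at h
  rw [h]
  refine Finset.sum_congr rfl fun j _ ↦ ?_
  cases j with
  | zero => simp
  | succ j =>
    rw [coeff_X_mul, coeff_derivative, coeff_fiber]
    push_cast
    ring

variable {f : BivariatePoly} {w α β : ℤ}

theorem IsQuasiHomogeneousOfType.eval_coeff (hf : f.IsQuasiHomogeneousOfType w α β) {t : ℂ}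
    (ht : t ≠ 0) (a : ℂ) (j : ℕ) :
    (f.coeff j).eval (t ^ α * a) * (t ^ β) ^ j = t ^ w * (f.coeff j).eval a := by
  rw [eval_eq_sum_range, eval_eq_sum_range, Finset.sum_mul, Finset.mul_sum]
  refine Finset.sum_congr rfl fun i _ ↦ ?_
  by_cases h : (f.coeff j).coeff i = 0
  · simp [h]
  · rw [hf.2 i j h, zpow_add₀ ht, zpow_mul, zpow_mul, zpow_natCast, zpow_natCast, mul_pow]
    ring

/-- Nondegeneracy of fibres is invariant under the torus action of weights `α`, `β`. -/
theorem IsQuasiHomogeneousOfType.isNondegenerateAt (hf : f.IsQuasiHomogeneousOfType w α β) {t : ℂ}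
    (ht : t ≠ 0) {a : ℂ} (ha : f.IsNondegenerateAt a) : f.IsNondegenerateAt (t ^ α * a) := by
  have htw : t ^ w ≠ 0 := zpow_ne_zero _ ht
  have htb : t ^ β ≠ 0 := zpow_ne_zero _ ht
  have hcoeff := hf.eval_coeff ht a
  obtain ⟨h1, h2, h3⟩ := ha
  refine ⟨fun h ↦ ?_, fun h ↦ ?_, fun y hy hy' ↦ ?_⟩
  · have := hcoeff f.natDegree
    rw [h, zero_mul, eq_comm, mul_eq_zero] at this
    exact this.elim htw h1
  · have := hcoeff 0
    rw [h, zero_mul, eq_comm, mul_eq_zero] at this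
    exact this.elim htw h2
  · obtain ⟨z, rfl⟩ : ∃ z, y = t ^ β * z := ⟨(t ^ β)⁻¹ * y, by field_simp⟩
    have e1 : (f.fiber (t ^ α * a)).eval (t ^ β * z) = t ^ w * (f.fiber a).eval z := by
      rw [eval_fiber, eval_fiber, Finset.mul_sum]
      refine Finset.sum_congr rfl fun j _ ↦ ?_
      rw [← mul_assoc, ← hcoeff j, mul_pow]
      ring
    have e2 : t ^ β * z * (f.fiber (t ^ α * a)).derivative.eval (t ^ β * z) =
        t ^ w * (z * (f.fiber a).derivative.eval z) := by
      rw [mul_eval_derivative_fiber, mul_eval_derivative_fiber, Finset.mul_sum]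
      refine Finset.sum_congr rfl fun j _ ↦ ?_
      rw [← mul_assoc (t ^ w), ← hcoeff j, mul_pow]
      ring
    rw [hy, eq_comm, mul_eq_zero, or_iff_right htw] at e1
    have hz : z ≠ 0 := by
      rintro rfl
      refine h2 ?_
      rwa [← coeff_fiber, coeff_zero_eq_eval_zero]
    rw [hy', mul_zero, eq_comm, mul_eq_zero, or_iff_right htw, mul_eq_zero, or_iff_right hz] at e2
    exact h3 z e1 e2

theorem exists_isNondegenerateAt (hf : Squarefree f) (hf_zero : f.coeff 0 ≠ 0) :
    ∃ a : ℂ, a ≠ 0 ∧ f.IsNondegenerateAt a := by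
  have hf0 : f ≠ 0 := by
    rintro rfl
    simp at hf_zero
  have hprod : X * (f.coeff 0 * (f.leadingCoeff * f.discY)) ≠ 0 := by
    simp [hf_zero, hf0, discY_ne_zero hf hf0]
  obtain ⟨a, ha⟩ := exists_eval_ne_zero_of_natDegree_lt_card _ hprod
    (Cardinal.natCast_lt_aleph0.trans_le (Cardinal.aleph0_le_mk ℂ))
  simp only [eval_mul, eval_X, mul_ne_zero_iff] at ha
  exact ⟨a, ha.1, isNondegenerateAt_iff.mpr ⟨ha.2.1, ha.2.2.1, ha.2.2.2⟩⟩

/-- The torus acts transitively on `ℂˣ` as soon as the weight of `x` is nonzero. -/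
theorem IsQuasiHomogeneousOfType.isNondegenerateAt_of_squarefree
    (hf : f.IsQuasiHomogeneousOfType w α β) (hα : α ≠ 0) (hsq : Squarefree f)
    (hf_zero : f.coeff 0 ≠ 0) {a : ℂ} (ha : a ≠ 0) : f.IsNondegenerateAt a := by
  obtain ⟨b, hb, hfb⟩ := exists_isNondegenerateAt hsq hf_zero
  have hab : a / b ≠ 0 := div_ne_zero ha hb
  have hα' : (α : ℂ) ≠ 0 := Int.cast_ne_zero.mpr hα
  have ht : Complex.exp (Complex.log (a / b) / α) ^ α = a / b := by
    rw [← Complex.exp_int_mul, mul_div_cancel₀ _ hα', Complex.exp_log hab]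
  have h := hf.isNondegenerateAt (Complex.exp_ne_zero (Complex.log (a / b) / α)) hfb
  rwa [ht, div_mul_cancel₀ _ hb] at h

/-! ### Points of the multi-homogenization -/

theorem natDegree_coeff_le_xDegree (f : BivariatePoly) (j : ℕ) :
    (f.coeff j).natDegree ≤ f.xDegree := by
  by_cases h : f.coeff j = 0
  · simp [h]
  · exact Finset.le_sup (f := fun j ↦ (f.coeff j).natDegree) (mem_support_iff.mpr h)

theorem sum_coeff_mul_pow_mul_pow_sub {q : ℂ[X]} {m : ℕ} (hq : q.natDegree ≤ m) (a s : ℂ) :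
    ∑ i ∈ Finset.range (m + 1), q.coeff i * ((a * s) ^ i * s ^ (m - i)) = s ^ m * q.eval a := by
  rw [eval_eq_sum_range' (Nat.lt_succ_of_le hq), Finset.mul_sum]
  refine Finset.sum_congr rfl fun i hi ↦ ?_
  rw [← pow_sub_mul_pow s (Nat.lt_succ_iff.mp (Finset.mem_range.mp hi)), mul_pow]
  ring

theorem eval_multiHomogenization (f : BivariatePoly) (a s v₀ v₁ : ℂ) :
    MvPolynomial.eval ![a * s, s, v₀, v₁] f.multiHomogenization =
      s ^ f.xDegree * ∑ j ∈ Finset.range (f.natDegree + 1),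
        (f.coeff j).eval a * (v₀ ^ j * v₁ ^ (f.natDegree - j)) := by
  rw [multiHomogenization, map_sum, Finset.mul_sum, yDegree]
  refine Finset.sum_congr rfl fun j _ ↦ ?_
  rw [← mul_assoc, ← sum_coeff_mul_pow_mul_pow_sub (natDegree_coeff_le_xDegree f j), map_sum,
    Finset.sum_mul]
  refine Finset.sum_congr rfl fun i _ ↦ ?_
  simp
  ring

theorem eval_mul_pderiv_multiHomogenization (f : BivariatePoly) (a s v₀ v₁ : ℂ) :
    MvPolynomial.eval ![a * s, s, v₀, v₁]
        (MvPolynomial.X 2 * MvPolynomial.pderiv 2 f.multiHomogenization) =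
      s ^ f.xDegree * ∑ j ∈ Finset.range (f.natDegree + 1),
        (f.coeff j).eval a * (j * (v₀ ^ j * v₁ ^ (f.natDegree - j))) := by
  rw [multiHomogenization, map_sum, Finset.mul_sum, map_sum, Finset.mul_sum, yDegree]
  refine Finset.sum_congr rfl fun j _ ↦ ?_
  rw [← mul_assoc, ← sum_coeff_mul_pow_mul_pow_sub (natDegree_coeff_le_xDegree f j), map_sum,
    Finset.mul_sum, map_sum, Finset.sum_mul]
  refine Finset.sum_congr rfl fun i _ ↦ ?_
  have hX : v₀ * ((j : ℂ) * v₀ ^ (j - 1)) = j * v₀ ^ j := by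
    cases j with
    | zero => simp
    | succ j => rw [Nat.add_sub_cancel]; ring
  simp [Derivation.leibniz, Derivation.leibniz_pow, MvPolynomial.pderiv_X]
  linear_combination ((f.coeff j).coeff i * ((a * s) ^ i * s ^ (f.xDegree - i)) *
    v₁ ^ (f.natDegree - j)) * hX

/-- Dehomogenization in `y` at the point `[y : 1]`. -/
theorem sum_mul_pow_mul_pow_sub (c : ℕ → ℂ) (n : ℕ) (y s : ℂ) :
    ∑ j ∈ Finset.range (n + 1), c j * ((y * s) ^ j * s ^ (n - j)) =
      s ^ n * ∑ j ∈ Finset.range (n + 1), c j * y ^ j := by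
  rw [Finset.mul_sum]
  refine Finset.sum_congr rfl fun j hj ↦ ?_
  rw [← pow_sub_mul_pow s (Nat.lt_succ_iff.mp (Finset.mem_range.mp hj)), mul_pow]
  ring

/-- Dehomogenization in `y` at the point `[1 : 0]`: only the top coefficient survives. -/
theorem sum_mul_pow_mul_zero_pow_sub (c : ℕ → ℂ) (n : ℕ) (v : ℂ) :
    ∑ j ∈ Finset.range (n + 1), c j * (v ^ j * 0 ^ (n - j)) = c n * v ^ n := by
  rw [Finset.sum_range_succ, Finset.sum_eq_zero]
  · simp
  · intro j hj
    rw [zero_pow (Nat.sub_ne_zero_of_lt (Finset.mem_range.mp hj))]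
    simp

theorem eval_multiHomogenization_affine (f : BivariatePoly) (a s y r : ℂ) :
    MvPolynomial.eval ![a * s, s, y * r, r] f.multiHomogenization =
      s ^ f.xDegree * (r ^ f.natDegree * (f.fiber a).eval y) := by
  rw [eval_multiHomogenization, sum_mul_pow_mul_pow_sub, eval_fiber]

theorem eval_mul_pderiv_multiHomogenization_affine (f : BivariatePoly) (a s y r : ℂ) :
    MvPolynomial.eval ![a * s, s, y * r, r]
        (MvPolynomial.X 2 * MvPolynomial.pderiv 2 f.multiHomogenization) =
      s ^ f.xDegree * (r ^ f.natDegree * (y * (f.fiber a).derivative.eval y)) := by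
  rw [eval_mul_pderiv_multiHomogenization, mul_eval_derivative_fiber]
  have := sum_mul_pow_mul_pow_sub (fun j ↦ (f.coeff j).eval a * j) f.natDegree y r
  simp only [mul_assoc] at this ⊢
  rw [this]

theorem eval_multiHomogenization_infty (f : BivariatePoly) (a s r : ℂ) :
    MvPolynomial.eval ![a * s, s, r, 0] f.multiHomogenization =
      s ^ f.xDegree * ((f.coeff f.natDegree).eval a * r ^ f.natDegree) := by
  rw [eval_multiHomogenization, sum_mul_pow_mul_zero_pow_sub]

theorem eval_mul_pderiv_multiHomogenization_infty (f : BivariatePoly) (a s r : ℂ) :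
    MvPolynomial.eval ![a * s, s, r, 0]
        (MvPolynomial.X 2 * MvPolynomial.pderiv 2 f.multiHomogenization) =
      s ^ f.xDegree * ((f.coeff f.natDegree).eval a * (f.natDegree * r ^ f.natDegree)) := by
  rw [eval_mul_pderiv_multiHomogenization]
  have := sum_mul_pow_mul_zero_pow_sub (fun j ↦ (f.coeff j).eval a * j) f.natDegree r
  simp only [mul_assoc] at this ⊢
  rw [this]

/-- The homogeneous coordinates of `[a : b]` are the multiples of `(a, b)`. -/
theorem exists_eq_mul_of_mk_eq {a b : ℂ} {u : Fin 2 → ℂ} {hu : u ≠ 0}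
    {h : (![a, b] : Fin 2 → ℂ) ≠ 0}
    (he : Projectivization.mk ℂ u hu = Projectivization.mk ℂ ![a, b] h) :
    ∃ s, u 0 = a * s ∧ u 1 = b * s := by
  obtain ⟨s, rfl⟩ := (Projectivization.mk_eq_mk_iff' ℂ _ _ _ _).mp he
  exact ⟨s, by simp [mul_comm], by simp [mul_comm]⟩

/-- The common points of `f̂` and `y f̂_y` over `ℂˣ` lie over the degenerate fibres: they are the
point `[1 : 0]` where `f_n` vanishes, the point `[0 : 1]` where `f_0` vanishes, and the multiple
roots. -/
theorem zeroLocus_inter_eq_empty_iff (f : BivariatePoly) :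
    ProjLine.zeroLocus f.multiHomogenization ∩
        ProjLine.zeroLocus (MvPolynomial.X 2 * MvPolynomial.pderiv 2 f.multiHomogenization) ∩
        ProjLine.puncturedLine ×ˢ Set.univ = ∅ ↔
      ∀ a : ℂ, a ≠ 0 → f.IsNondegenerateAt a := by
  have hx (a : ℂ) : (![a, 1] : Fin 2 → ℂ) ≠ 0 := fun h ↦ by simpa using congrFun h 1
  have hinf : (![1, 0] : Fin 2 → ℂ) ≠ 0 := fun h ↦ by simpa using congrFun h 0
  constructor
  · intro hempty a ha
    have key (P : ProjLine) : ¬ (((Projectivization.mk ℂ ![a, 1] (hx a), P) : ProjLine × ProjLine) ∈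
        ProjLine.zeroLocus f.multiHomogenization ∩
        ProjLine.zeroLocus (MvPolynomial.X 2 * MvPolynomial.pderiv 2 f.multiHomogenization)) := by
      intro hP
      have : ((Projectivization.mk ℂ ![a, 1] (hx a), P) : ProjLine × ProjLine) ∈
          (∅ : Set (ProjLine × ProjLine)) := hempty ▸ ⟨hP, ⟨a, ha, hx a, rfl⟩, trivial⟩
      exact this
    have affine (y : ℂ) (h1 : (f.fiber a).eval y = 0)
        (h2 : y * (f.fiber a).derivative.eval y = 0) : False := by
      refine key (Projectivization.mk ℂ ![y, 1] (hx y)) ⟨?_, ?_⟩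
      all_goals
        intro u v hu hv hu' hv'
        obtain ⟨s, hs0, hs1⟩ := exists_eq_mul_of_mk_eq hu'
        obtain ⟨r, hr0, hr1⟩ := exists_eq_mul_of_mk_eq hv'
        rw [hs0, hs1, hr0, hr1, one_mul, one_mul]
      · rw [eval_multiHomogenization_affine, h1, mul_zero, mul_zero]
      · rw [eval_mul_pderiv_multiHomogenization_affine, h2, mul_zero, mul_zero]
    refine ⟨fun h ↦ ?_, fun h ↦ ?_, fun y h1 h2 ↦ affine y h1 (by rw [h2, mul_zero])⟩
    · refine key (Projectivization.mk ℂ ![1, 0] hinf) ⟨?_, ?_⟩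
      all_goals
        intro u v hu hv hu' hv'
        obtain ⟨s, hs0, hs1⟩ := exists_eq_mul_of_mk_eq hu'
        obtain ⟨r, hr0, hr1⟩ := exists_eq_mul_of_mk_eq hv'
        rw [hs0, hs1, hr0, hr1, one_mul, one_mul, zero_mul]
      · rw [eval_multiHomogenization_infty, h, zero_mul, mul_zero]
      · rw [eval_mul_pderiv_multiHomogenization_infty, h, zero_mul, mul_zero]
    · exact affine 0 (by rw [← coeff_zero_eq_eval_zero, coeff_fiber, h]) (zero_mul _)
  · intro hgood
    rw [Set.eq_empty_iff_forall_notMem]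
    rintro ⟨_, Q⟩ ⟨⟨hP1, hP2⟩, ⟨a, ha, h, rfl⟩, -⟩
    obtain ⟨h1, h2, h3⟩ := hgood a ha
    induction Q using Projectivization.ind with | h v hv =>
    have e1 := hP1 ![a, 1] v h hv rfl rfl
    have e2 := hP2 ![a, 1] v h hv rfl rfl
    have hu : (![(![a, 1] : Fin 2 → ℂ) 0, (![a, 1] : Fin 2 → ℂ) 1, v 0, v 1]) =
        ![a * 1, 1, v 0, v 1] := by simp
    rw [hu] at e1 e2
    by_cases hv1 : v 1 = 0
    · have hv0 : v 0 ≠ 0 := by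
        intro hv0
        refine hv (funext fun i ↦ ?_)
        fin_cases i
        · exact hv0
        · exact hv1
      rw [hv1, eval_multiHomogenization_infty, one_pow, one_mul] at e1
      exact mul_ne_zero h1 (pow_ne_zero _ hv0) e1
    · have hv0 : v 0 = v 0 / v 1 * v 1 := by field_simp
      rw [hv0] at e1 e2
      rw [eval_multiHomogenization_affine, one_pow, one_mul, mul_eq_zero,
        or_iff_right (pow_ne_zero _ hv1)] at e1
      rw [eval_mul_pderiv_multiHomogenization_affine, one_pow, one_mul, mul_eq_zero,
        or_iff_right (pow_ne_zero _ hv1), mul_eq_zero] at e2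
      refine e2.elim (fun hy ↦ h2 ?_) (h3 _ e1)
      rwa [hy, ← coeff_zero_eq_eval_zero, coeff_fiber] at e1

end BivariatePoly

/-! ### Entire functions of exponential growth -/

/-- A nowhere vanishing entire function of exponential growth is an exponential function, since
its logarithm has real part bounded above by an affine function of `‖z‖`. -/
theorem exists_eq_mul_exp_of_norm_le {Y : ℂ → ℂ} (hY : Differentiable ℂ Y) (h0 : ∀ z, Y z ≠ 0)
    {A K : ℝ} (hbound : ∀ z, ‖Y z‖ ≤ A * Real.exp (K * ‖z‖)) :
    ∃ a : ℂ, ∀ z, Y z = Y 0 * Complex.exp (a * z) := by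
  have hlog : Differentiable ℂ fun z ↦ deriv Y z / Y z := hY.deriv.div hY h0
  obtain ⟨g, hg0, hg⟩ := hlog.isExactOn_univ.with_val_at 0 0
  replace hg : ∀ z, HasDerivAt g (deriv Y z / Y z) z := fun z ↦ hg z trivial
  have hgd : Differentiable ℂ g := fun z ↦ (hg z).differentiableAt
  have hYg (z : ℂ) : Y z = Y 0 * Complex.exp (g z) := by
    have hd (z : ℂ) : HasDerivAt (fun z ↦ Y z * Complex.exp (-g z)) 0 z := by
      convert! (hY z).hasDerivAt.mul (hg z).neg.cexp using 1
      field_simp [h0 z]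
      ring
    have := is_const_of_deriv_eq_zero (fun z ↦ (hd z).differentiableAt) (fun z ↦ (hd z).deriv) z 0
    simp only [hg0, neg_zero, Complex.exp_zero, mul_one] at this
    rw [← this, mul_assoc, ← Complex.exp_add]
    simp
  have hA : 0 < A := by
    have := (norm_pos_iff.mpr (h0 0)).trans_le (hbound 0)
    simpa using this
  -- `B` and `K'` are nonnegative constants with `re g ≤ B + K' ‖z‖`
  obtain ⟨B, K', hB, hK', hre⟩ : ∃ B K' : ℝ, 0 < B ∧ 0 ≤ K' ∧ ∀ z, (g z).re ≤ B + K' * ‖z‖ := by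
    refine ⟨|Real.log (A / ‖Y 0‖)| + 1, |K|, by positivity, abs_nonneg _, fun z ↦ ?_⟩
    have h1 := hbound z
    have hY0 : 0 < ‖Y 0‖ := norm_pos_iff.mpr (h0 0)
    rw [hYg z, norm_mul, Complex.norm_exp, ← le_div_iff₀' hY0] at h1
    have h2 := Real.log_le_log (Real.exp_pos _) h1
    rw [Real.log_exp, mul_div_right_comm, Real.log_mul (by positivity) (Real.exp_pos _).ne',
      Real.log_exp] at h2
    have h3 : K * ‖z‖ ≤ |K| * ‖z‖ := mul_le_mul_of_nonneg_right (le_abs_self K) (norm_nonneg z)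
    linarith [le_abs_self (Real.log (A / ‖Y 0‖))]
  have hnorm (z : ℂ) : ‖g z‖ ≤ 2 * (B + K' * (2 * ‖z‖ + 1)) := by
    have hz := norm_nonneg z
    have hR : 0 < 2 * ‖z‖ + 1 := by positivity
    have hM : 0 < B + K' * (2 * ‖z‖ + 1) := by positivity
    have h1 := Complex.borelCaratheodory_zero (z := z) (R := 2 * ‖z‖ + 1) hM hgd.differentiableOn
      (fun x hx ↦ ?_) hR (by rw [mem_ball_zero_iff]; linarith) hg0
    · refine h1.trans ?_
      rw [div_le_iff₀ (by linarith)]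
      nlinarith
    · rw [mem_ball_zero_iff] at hx
      exact (hre x).trans (by gcongr)
  have hderiv (z : ℂ) : ‖deriv g z‖ ≤ 2 * B + 8 * K' := by
    have hz := norm_nonneg z
    have h1 := Complex.norm_deriv_le_of_forall_mem_sphere_norm_le (c := z) (R := ‖z‖ + 1)
      (C := 2 * (B + K' * (2 * (2 * ‖z‖ + 1) + 1))) (by positivity) hgd.diffContOnCl (fun x hx ↦ ?_)
    · refine h1.trans ?_
      rw [div_le_iff₀ (by positivity)]
      nlinarith
    · have hx' : ‖x‖ ≤ 2 * ‖z‖ + 1 := by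
        have := norm_le_norm_add_norm_sub' x z
        rw [mem_sphere_iff_norm.mp hx] at this
        linarith
      exact (hnorm x).trans (by gcongr)
  have hconst (z : ℂ) : deriv g z = deriv g 0 :=
    hgd.deriv.apply_eq_apply_of_bounded
      (isBounded_iff_forall_norm_le.mpr ⟨_, Set.forall_mem_range.mpr hderiv⟩) z 0
  refine ⟨deriv g 0, fun z ↦ ?_⟩
  have hd (z : ℂ) : HasDerivAt (fun z ↦ g z - deriv g 0 * z) 0 z := by
    convert! (hgd z).hasDerivAt.sub ((hasDerivAt_id z).const_mul (deriv g 0)) using 1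
    rw [hconst z]
    simp
  have := is_const_of_deriv_eq_zero (fun z ↦ (hd z).differentiableAt) (fun z ↦ (hd z).deriv) z 0
  rw [hYg z, sub_eq_iff_eq_add.mp this, hg0]
  simp

/-- Two exponential functions without a common value have the same exponent. -/
theorem eq_of_mul_exp_ne {a a' b b' : ℂ} (hb : b ≠ 0) (hb' : b' ≠ 0)
    (h : ∀ z, b * Complex.exp (a * z) ≠ b' * Complex.exp (a' * z)) : a = a' := by
  by_contra hne
  have hne' : a - a' ≠ 0 := sub_ne_zero.mpr hne
  refine h (Complex.log (b' / b) / (a - a')) ?_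
  have h1 : Complex.exp (a * (Complex.log (b' / b) / (a - a'))) =
      Complex.exp (Complex.log (b' / b)) *
        Complex.exp (a' * (Complex.log (b' / b) / (a - a'))) := by
    rw [← Complex.exp_add]
    congr 1
    field_simp
    ring
  rw [h1, Complex.exp_log (div_ne_zero hb' hb)]
  field_simp

theorem natCast_eq_of_eval_exp_eq {q : ℂ[X]} {d c : ℂ}
    (h : ∀ z, q.eval (Complex.exp z) = d * Complex.exp (c * z)) {i : ℕ} (hi : q.coeff i ≠ 0) :
    (i : ℂ) = c := by
  -- both sides are eigenfunctions of `d/dz`, which acts on polynomials in `exp z` as `x d/dx`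
  have hd (z : ℂ) : q.derivative.eval (Complex.exp z) * Complex.exp z =
      c * q.eval (Complex.exp z) := by
    have h1 : HasDerivAt (fun z ↦ q.eval (Complex.exp z))
        (q.derivative.eval (Complex.exp z) * Complex.exp z) z :=
      (q.hasDerivAt _).comp z (Complex.hasDerivAt_exp z)
    have h2 : HasDerivAt (fun z ↦ q.eval (Complex.exp z))
        (d * (Complex.exp (c * z) * (c * 1))) z := by
      simp_rw [h]
      exact (((hasDerivAt_id z).const_mul c).cexp).const_mul d
    rw [h1.unique h2, h]
    ring
  have hpoly : X * q.derivative = C c * q := by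
    refine eq_of_infinite_eval_eq _ _ (Set.Infinite.mono (s := {0}ᶜ) (fun x hx ↦ ?_)
      (Set.finite_singleton 0).infinite_compl)
    have := hd (Complex.log x)
    rw [Complex.exp_log hx] at this
    simp only [Set.mem_ofPred_eq, eval_mul, eval_X, eval_C]
    rw [← this, mul_comm]
  have := congrArg (coeff · i) hpoly
  simp only [coeff_C_mul] at this
  refine mul_right_cancel₀ hi (this.symm.trans ?_).symm
  cases i with
  | zero => simp
  | succ i =>
    rw [coeff_X_mul, coeff_derivative]
    push_cast
    ring

/-! ### Roots of a family of separable polynomials -/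

section RootCovering

open Filter Topology

variable {p : ℂ → ℂ[X]} {n : ℕ}

theorem contDiff_eval_family (hp : ∀ j, Differentiable ℂ fun z ↦ (p z).coeff j)
    (hn : ∀ z, (p z).natDegree = n) : ContDiff ℂ 1 fun v : ℂ × ℂ ↦ (p v.1).eval v.2 := by
  simp_rw [eval_eq_sum_range, hn]
  refine ContDiff.sum fun j _ ↦ ?_
  exact ((hp j).contDiff.comp contDiff_fst).mul (contDiff_snd.pow j)

/-- Near a simple root, the roots form the graph of a differentiable function. -/
theorem exists_local_root (hp : ∀ j, Differentiable ℂ fun z ↦ (p z).coeff j)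
    (hn : ∀ z, (p z).natDegree = n) {u : ℂ × ℂ} (hu : (p u.1).eval u.2 = 0)
    (hu' : (p u.1).derivative.eval u.2 ≠ 0) :
    ∃ φ : ℂ → ℂ, DifferentiableAt ℂ φ u.1 ∧ φ u.1 = u.2 ∧
      (∀ᶠ z in 𝓝 u.1, (p z).eval (φ z) = 0) ∧
      ∀ᶠ v : ℂ × ℂ in 𝓝 u, (p v.1).eval v.2 = 0 → φ v.1 = v.2 := by
  have hF := ((contDiff_eval_family hp hn).contDiffAt (x := u)).hasStrictFDerivAt one_ne_zero
  set F' := fderiv ℂ (fun v : ℂ × ℂ ↦ (p v.1).eval v.2) u with hF'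
  have hpartial : F' ∘L .inr ℂ ℂ ℂ =
      ((ContinuousLinearEquiv.unitsEquivAut ℂ (Units.mk0 _ hu') : ℂ ≃L[ℂ] ℂ) : ℂ →L[ℂ] ℂ) := by
    have h1 : HasFDerivAt (fun y ↦ (p u.1).eval y) (F' ∘L .inr ℂ ℂ ℂ) u.2 :=
      HasFDerivAt.comp u.2 (f := fun y ↦ (u.1, y)) (g := fun v : ℂ × ℂ ↦ (p v.1).eval v.2)
        hF.hasFDerivAt (hasFDerivAt_prodMk_right u.1 u.2)
    rw [h1.unique ((p u.1).hasDerivAt u.2).hasFDerivAt]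
    ext
    simp
  have hinv : (F' ∘L .inr ℂ ℂ ℂ).IsInvertible := ⟨_, hpartial.symm⟩
  have hiff := hF.eventually_apply_eq_iff_implicitFunctionOfProdDomain hinv
  refine ⟨hF.implicitFunctionOfProdDomain hinv,
    (hF.hasStrictFDerivAt_implicitFunctionOfProdDomain hinv).differentiableAt,
    hiff.self_of_nhds.mp rfl, ?_, ?_⟩
  · filter_upwards [hF.eventually_apply_implicitFunctionOfProdDomain hinv] with z hz
    rw [hz, hu]
  · filter_upwards [hiff] with v hv hv0
    exact hv.mp (hv0.trans hu.symm)

/-- The projection to `ℂ` of the space of roots of a family of polynomials. -/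
def rootProj (p : ℂ → ℂ[X]) : {v : ℂ × ℂ // (p v.1).eval v.2 = 0} → ℂ := fun v ↦ v.1.1

theorem continuous_rootProj : Continuous (rootProj p) := continuous_fst.comp continuous_subtype_val

/-- A root `y` of a polynomial of degree `n` satisfies `|y| ≤ 1 + ∑_{j < n} |c_j / c_n|`. -/
theorem norm_root_le {q : ℂ[X]} (hq : q ≠ 0) {y : ℂ} (hy : q.eval y = 0) :
    ‖y‖ ≤ 1 + ∑ j ∈ Finset.range q.natDegree, ‖q.coeff j‖ / ‖q.leadingCoeff‖ := by
  have hsum : 0 ≤ ∑ j ∈ Finset.range q.natDegree, ‖q.coeff j‖ / ‖q.leadingCoeff‖ :=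
    Finset.sum_nonneg fun j _ ↦ by positivity
  by_cases hy1 : ‖y‖ ≤ 1
  · linarith
  have hlc : 0 < ‖q.leadingCoeff‖ := norm_pos_iff.mpr (leadingCoeff_ne_zero.mpr hq)
  rw [eval_eq_sum_range, Finset.sum_range_succ, add_eq_zero_iff_neg_eq, coeff_natDegree] at hy
  have hn : q.natDegree ≠ 0 := by
    intro h0
    rw [h0] at hy
    simp at hy
    exact leadingCoeff_ne_zero.mpr hq hy.symm
  rw [not_le] at hy1
  have h1 : ‖q.leadingCoeff‖ * ‖y‖ ^ q.natDegree ≤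
      (∑ j ∈ Finset.range q.natDegree, ‖q.coeff j‖) * ‖y‖ ^ (q.natDegree - 1) := by
    rw [← norm_pow, ← norm_mul, ← hy, norm_neg, Finset.sum_mul]
    refine (norm_sum_le _ _).trans (Finset.sum_le_sum fun j hj ↦ ?_)
    rw [norm_mul, norm_pow]
    gcongr
    · exact hy1.le
    · have := Finset.mem_range.mp hj
      omega
  rw [← Nat.sub_add_cancel (Nat.one_le_iff_ne_zero.mpr hn), Nat.add_sub_cancel, pow_succ',
    ← mul_assoc, Nat.sub_add_cancel (Nat.one_le_iff_ne_zero.mpr hn)] at h1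
  have h2 := le_of_mul_le_mul_right h1 (by positivity)
  rw [← Finset.sum_div]
  have : ‖y‖ ≤ (∑ j ∈ Finset.range q.natDegree, ‖q.coeff j‖) / ‖q.leadingCoeff‖ := by
    rw [le_div_iff₀ hlc]
    linarith
  linarith

theorem isProperMap_rootProj (hp : ∀ j, Differentiable ℂ fun z ↦ (p z).coeff j)
    (hn : ∀ z, (p z).natDegree = n) (hp0 : ∀ z, p z ≠ 0) : IsProperMap (rootProj p) := by
  refine isProperMap_iff_isCompact_preimage.mpr ⟨continuous_rootProj, fun K hK ↦ ?_⟩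
  have hcont : Continuous fun z ↦
      1 + ∑ j ∈ Finset.range n, ‖(p z).coeff j‖ / ‖(p z).coeff n‖ := by
    refine continuous_const.add (continuous_finsetSum _ fun j _ ↦
      (hp j).continuous.norm.div (hp n).continuous.norm fun z ↦ ?_)
    rw [← hn z]
    exact norm_ne_zero_iff.mpr (leadingCoeff_ne_zero.mpr (hp0 z))
  obtain ⟨R, hR⟩ := (hK.image hcont).bddAbove
  have hclosed : IsClosed {v : ℂ × ℂ | (p v.1).eval v.2 = 0} :=
    isClosed_eq (contDiff_eval_family hp hn).continuous continuous_const
  refine (hclosed.isClosedEmbedding_subtypeVal.isCompact_preimage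
    (hK.prod (isCompact_closedBall (0 : ℂ) R))).of_isClosed_subset
    (hK.isClosed.preimage continuous_rootProj) fun v hv ↦ ⟨hv, ?_⟩
  have h1 := norm_root_le (hp0 v.1.1) v.2
  simp only [leadingCoeff, hn] at h1
  rw [mem_closedBall_zero_iff]
  exact h1.trans (hR ⟨_, hv, rfl⟩)

theorem isLocalHomeomorph_rootProj (hp : ∀ j, Differentiable ℂ fun z ↦ (p z).coeff j)
    (hn : ∀ z, (p z).natDegree = n)
    (hs : ∀ z y, (p z).eval y = 0 → (p z).derivative.eval y ≠ 0) :
    IsLocalHomeomorph (rootProj p) := by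
  have hopen : IsOpenMap (rootProj p) := by
    refine isOpenMap_iff_nhds_le.mpr fun ⟨u, hu⟩ ↦ ?_
    obtain ⟨φ, hφ, hφu, hroot, -⟩ := exists_local_root hp hn hu (hs _ _ hu)
    intro s hs
    obtain ⟨t, ht, hts⟩ := (mem_nhds_subtype _ _ _).mp (mem_map.mp hs)
    have htend : Tendsto (fun z ↦ (z, φ z)) (𝓝 u.1) (𝓝 u) := by
      have := tendsto_id.prodMk_nhds hφ.continuousAt.tendsto
      rwa [hφu] at this
    filter_upwards [hroot, htend ht] with z hz hzt
    exact hts (a := ⟨(z, φ z), hz⟩) hzt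
  refine isLocalHomeomorph_iff_isOpenEmbedding_restrict.mpr fun ⟨u, hu⟩ ↦ ?_
  obtain ⟨φ, -, -, -, huniq⟩ := exists_local_root hp hn hu (hs _ _ hu)
  obtain ⟨W, hW, hWo, huW⟩ := eventually_nhds_iff.mp huniq
  have hU : IsOpen (Subtype.val ⁻¹' W : Set {v : ℂ × ℂ // (p v.1).eval v.2 = 0}) :=
    hWo.preimage continuous_subtype_val
  refine ⟨_, hU.mem_nhds huW, .of_continuous_injective_isOpenMap
    (continuous_rootProj.comp continuous_subtype_val) ?_ (hopen.domRestrict hU)⟩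
  rintro ⟨⟨v, hv⟩, hvW⟩ ⟨⟨v', hv'⟩, hvW'⟩ (h : v.1 = v'.1)
  have h2 : v.2 = v'.2 := by rw [← hW v hvW hv, ← hW v' hvW' hv', h]
  simp only [Subtype.mk.injEq]
  exact Prod.ext h h2

theorem isCoveringMap_rootProj (hp : ∀ j, Differentiable ℂ fun z ↦ (p z).coeff j)
    (hn : ∀ z, (p z).natDegree = n) (hp0 : ∀ z, p z ≠ 0)
    (hs : ∀ z y, (p z).eval y = 0 → (p z).derivative.eval y ≠ 0) :
    IsCoveringMap (rootProj p) := by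
  rw [isCoveringMap_iff_isCoveringMapOn_univ]
  refine (isProperMap_rootProj hp hn hp0).isClosedMap.isCoveringMapOn_of_isLocalHomeomorphOn
    (fun z _ ↦ ?_) (isLocalHomeomorph_rootProj hp hn hs).isLocalHomeomorphOn
  refine Set.Finite.of_finite_image (f := fun v ↦ v.1.2)
    (((p z).roots.toFinset.finite_toSet).subset ?_) ?_
  · rintro _ ⟨⟨v, hv⟩, rfl, rfl⟩
    simpa [rootProj, hp0] using hv
  · rintro ⟨v, hv⟩ (h : v.1 = z) ⟨v', hv'⟩ (h' : v'.1 = z) (h2 : v.2 = v'.2)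
    exact Subtype.ext (Prod.ext (h.trans h'.symm) h2)

/-- Since `ℂ` is simply connected, each root of `p 0` extends to an entire root of the family. -/
theorem exists_entire_root (hp : ∀ j, Differentiable ℂ fun z ↦ (p z).coeff j)
    (hn : ∀ z, (p z).natDegree = n) (hp0 : ∀ z, p z ≠ 0)
    (hs : ∀ z y, (p z).eval y = 0 → (p z).derivative.eval y ≠ 0) {b : ℂ}
    (hb : (p 0).eval b = 0) :
    ∃ Y : ℂ → ℂ, Differentiable ℂ Y ∧ Y 0 = b ∧ ∀ z, (p z).eval (Y z) = 0 := by
  obtain ⟨F, ⟨hF0, hF⟩, -⟩ := (isCoveringMap_rootProj hp hn hp0 hs).existsUnique_continuousMap_lifts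
    (ContinuousMap.id ℂ) 0 ⟨(0, b), hb⟩ rfl
  have hF1 (z : ℂ) : (F z).1.1 = z := congrFun hF z
  have hroot (z : ℂ) : (p z).eval (F z).1.2 = 0 := by
    have := (F z).2
    rwa [hF1 z] at this
  refine ⟨fun z ↦ (F z).1.2, fun z ↦ ?_, by simp only [hF0], hroot⟩
  obtain ⟨φ, hφ, -, -, huniq⟩ := exists_local_root (u := (z, (F z).1.2)) hp hn (hroot z)
    (hs _ _ (hroot z))
  have hcont : Continuous fun w ↦ (F w).1.2 :=
    continuous_snd.comp (continuous_subtype_val.comp F.continuous)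
  have htend : Tendsto (fun w ↦ (w, (F w).1.2)) (𝓝 z) (𝓝 (z, (F z).1.2)) :=
    (continuous_id.prodMk hcont).tendsto z
  refine hφ.congr_of_eventuallyEq ?_
  filter_upwards [htend.eventually huniq] with w hw
  exact (hw (hroot w)).symm

/-- Entire roots of the family that differ somewhere differ everywhere. -/
theorem entire_root_ne (hp : ∀ j, Differentiable ℂ fun z ↦ (p z).coeff j)
    (hn : ∀ z, (p z).natDegree = n) (hp0 : ∀ z, p z ≠ 0)
    (hs : ∀ z y, (p z).eval y = 0 → (p z).derivative.eval y ≠ 0) {Y Y' : ℂ → ℂ}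
    (hY : Continuous Y) (hY' : Continuous Y') (hYr : ∀ z, (p z).eval (Y z) = 0)
    (hYr' : ∀ z, (p z).eval (Y' z) = 0) {w : ℂ} (hw : Y w ≠ Y' w) (z : ℂ) : Y z ≠ Y' z := by
  intro h
  have := (isCoveringMap_rootProj hp hn hp0 hs).eq_of_comp_eq
    (g₁ := fun z ↦ ⟨(z, Y z), hYr z⟩) (g₂ := fun z ↦ ⟨(z, Y' z), hYr' z⟩)
    (by fun_prop) (by fun_prop) rfl z (by simp [h])
  exact hw (congrArg (fun v ↦ v.1.2) (congrFun this w))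

end RootCovering

namespace BivariatePoly

/-! ### Nondegenerate fibres imply quasi-homogeneity -/

/-- A polynomial in `exp z` has exponential growth. -/
theorem norm_eval_exp_le (q : ℂ[X]) (z : ℂ) :
    ‖q.eval (Complex.exp z)‖ ≤
      (∑ i ∈ Finset.range (q.natDegree + 1), ‖q.coeff i‖) * Real.exp (q.natDegree * ‖z‖) := by
  rw [eval_eq_sum_range, Finset.sum_mul]
  refine (norm_sum_le _ _).trans (Finset.sum_le_sum fun i hi ↦ ?_)
  rw [norm_mul, norm_pow, Complex.norm_exp, ← Real.exp_nat_mul]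
  have hi' : (i : ℝ) ≤ q.natDegree := by
    exact_mod_cast Nat.lt_succ_iff.mp (Finset.mem_range.mp hi)
  have : z.re ≤ ‖z‖ := Complex.re_le_norm z
  refine mul_le_mul_of_nonneg_left (Real.exp_le_exp.mpr ?_) (norm_nonneg _)
  exact (mul_le_mul_of_nonneg_left this i.cast_nonneg).trans
    (mul_le_mul_of_nonneg_right hi' (norm_nonneg z))

/-- The roots of the fibres over `x = exp z` have at most exponential growth if the leading
coefficient is a monomial. -/
theorem exists_norm_root_le {f : BivariatePoly} {k : ℕ} {c : ℂ} (hc : c ≠ 0)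
    (hlead : f.coeff f.natDegree = monomial k c) :
    ∃ A K : ℝ, ∀ z y, (f.fiber (Complex.exp z)).eval y = 0 → ‖y‖ ≤ A * Real.exp (K * ‖z‖) := by
  set n := f.natDegree with hn
  set N : ℕ → ℝ := fun j ↦ ∑ i ∈ Finset.range ((f.coeff j).natDegree + 1), ‖(f.coeff j).coeff i‖
  set K : ℝ := ∑ j ∈ Finset.range n, ((f.coeff j).natDegree : ℝ) + k with hK
  have hNnn (j : ℕ) : 0 ≤ N j := Finset.sum_nonneg fun i _ ↦ norm_nonneg _
  refine ⟨1 + ∑ j ∈ Finset.range n, N j / ‖c‖, K, fun z y hy ↦ ?_⟩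
  have hlc : (f.coeff n).eval (Complex.exp z) = c * Complex.exp z ^ k := by
    rw [hlead, eval_monomial]
  have hlc0 : (f.coeff n).eval (Complex.exp z) ≠ 0 := by
    rw [hlc]
    exact mul_ne_zero hc (pow_ne_zero _ (Complex.exp_ne_zero z))
  have hdeg := natDegree_fiber hlc0
  have hq : f.fiber (Complex.exp z) ≠ 0 := by
    intro h0
    rw [← coeff_fiber, h0, coeff_zero] at hlc0
    exact hlc0 rfl
  have hK0 : 0 ≤ K := by positivity
  have h1 := norm_root_le hq hy
  simp only [leadingCoeff, hdeg, ← hn, coeff_fiber] at h1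
  refine h1.trans ?_
  rw [add_mul, one_mul, Finset.sum_mul]
  refine add_le_add (Real.one_le_exp (by positivity)) (Finset.sum_le_sum fun j hj ↦ ?_)
  have h2 : ‖(f.coeff n).eval (Complex.exp z)‖ = ‖c‖ * Real.exp (k * z.re) := by
    rw [hlc, norm_mul, norm_pow, Complex.norm_exp, ← Real.exp_nat_mul]
  have hc' : 0 < ‖c‖ := norm_pos_iff.mpr hc
  rw [h2, div_le_iff₀ (by positivity)]
  refine (norm_eval_exp_le (f.coeff j) z).trans ?_
  calc N j * Real.exp ((f.coeff j).natDegree * ‖z‖)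
      ≤ N j * Real.exp (K * ‖z‖ + k * z.re) := by
        refine mul_le_mul_of_nonneg_left (Real.exp_le_exp.mpr ?_) (hNnn j)
        have h3 : ((f.coeff j).natDegree : ℝ) ≤ ∑ j ∈ Finset.range n, ((f.coeff j).natDegree : ℝ) :=
          Finset.single_le_sum (f := fun j ↦ ((f.coeff j).natDegree : ℝ))
            (fun _ _ ↦ Nat.cast_nonneg _) hj
        have h4 : -‖z‖ ≤ z.re := neg_le_of_abs_le (Complex.abs_re_le_norm z)
        have h5 : (k : ℝ) * (-‖z‖) ≤ k * z.re := mul_le_mul_of_nonneg_left h4 (Nat.cast_nonneg k)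
        have h6 := mul_le_mul_of_nonneg_right h3 (norm_nonneg z)
        rw [hK]
        linarith
    _ = N j / ‖c‖ * Real.exp (K * ‖z‖) * (‖c‖ * Real.exp (k * z.re)) := by
        rw [Real.exp_add]
        field_simp

variable {f : BivariatePoly}

/-- If all fibres over `ℂˣ` are nondegenerate, then the roots of the fibre over `exp z` are the
functions `b * exp (a * z)` with `b` a root of the fibre over `1` and one common exponent `a`. -/
theorem exists_forall_root_exp (hf : ∀ x : ℂ, x ≠ 0 → f.IsNondegenerateAt x) :
    ∃ a : ℂ, ∀ z b, (f.fiber 1).eval b = 0 →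
      (f.fiber (Complex.exp z)).eval (b * Complex.exp (a * z)) = 0 := by
  set p : ℂ → ℂ[X] := fun z ↦ f.fiber (Complex.exp z) with hpdef
  have hgood (z : ℂ) := hf (Complex.exp z) (Complex.exp_ne_zero z)
  have hp (j : ℕ) : Differentiable ℂ fun z ↦ (p z).coeff j := by
    simp only [hpdef, coeff_fiber]
    exact (f.coeff j).differentiable.comp Complex.differentiable_exp
  have hn (z : ℂ) : (p z).natDegree = f.natDegree := natDegree_fiber (hgood z).1
  have hp0 (z : ℂ) : p z ≠ 0 := by
    intro h0
    have := (hgood z).1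
    rw [← coeff_fiber] at this
    exact this (by rw [show f.fiber (Complex.exp z) = 0 from h0, coeff_zero])
  have hs (z : ℂ) := (hgood z).2.2
  obtain ⟨k, c, hc, hlead⟩ := isNonzeroMonomial_iff_eval_ne_zero.mpr fun x hx ↦ (hf x hx).1
  obtain ⟨A, K, hAK⟩ := exists_norm_root_le hc hlead
  have hzero (z y : ℂ) (hy : (p z).eval y = 0) : y ≠ 0 := by
    rintro rfl
    rw [← coeff_zero_eq_eval_zero, hpdef, coeff_fiber] at hy
    exact (hgood z).2.1 hy
  have hexp (b : ℂ) (hb : (p 0).eval b = 0) :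
      ∃ a, ∀ z, (p z).eval (b * Complex.exp (a * z)) = 0 := by
    obtain ⟨Y, hYd, hY0, hY⟩ := exists_entire_root hp hn hp0 hs hb
    obtain ⟨a, ha⟩ := exists_eq_mul_exp_of_norm_le hYd (fun z ↦ hzero z _ (hY z))
      (fun z ↦ hAK z _ (hY z))
    refine ⟨a, fun z ↦ ?_⟩
    rw [← hY0, ← ha]
    exact hY z
  have hp1 : p 0 = f.fiber 1 := by rw [hpdef]; simp
  by_cases hex : ∃ b₀, (p 0).eval b₀ = 0
  · obtain ⟨b₀, hb₀⟩ := hex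
    obtain ⟨a, ha⟩ := hexp b₀ hb₀
    refine ⟨a, fun z b hb ↦ ?_⟩
    rw [← hp1] at hb
    by_cases hbb : b = b₀
    · rw [hbb]
      exact ha z
    obtain ⟨a', ha'⟩ := hexp b hb
    have hdisj := entire_root_ne hp hn hp0 hs (Y := fun z ↦ b * Complex.exp (a' * z))
      (Y' := fun z ↦ b₀ * Complex.exp (a * z)) (by fun_prop) (by fun_prop) ha' ha (w := 0)
      (by simpa using hbb)
    rw [← eq_of_mul_exp_ne (hzero 0 b hb) (hzero 0 b₀ hb₀) hdisj]
    exact ha' z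
  · refine ⟨0, fun z b hb ↦ absurd ⟨b, ?_⟩ hex⟩
    rwa [hp1]

theorem separable_of_simple_roots {q : ℂ[X]}
    (h : ∀ y, q.eval y = 0 → q.derivative.eval y ≠ 0) : q.Separable := by
  refine (isCoprime_iff_aeval_ne_zero_of_isAlgClosed ℂ ℂ q q.derivative).mpr fun y ↦ ?_
  simp only [coe_aeval_eq_eval]
  exact or_iff_not_imp_left.mpr fun hy ↦ h y (not_not.mp hy)

/-- A polynomial which has the degree and the (simple) roots of `q` is proportional to `q`. -/
theorem proportional_of_separable {q r : ℂ[X]} (hdeg : r.natDegree = q.natDegree)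
    (hsep : q.Separable) (hr : r ≠ 0) (hroot : ∀ y, q.eval y = 0 → r.eval y = 0) :
    C r.leadingCoeff * q = C q.leadingCoeff * r := by
  have hq : q ≠ 0 := hsep.ne_zero
  have hle : q.roots ≤ r.roots := by
    refine (Multiset.le_iff_subset (nodup_roots hsep)).mpr fun y hy ↦ ?_
    exact (mem_roots hr).mpr (hroot y ((mem_roots hq).mp hy))
  obtain ⟨s, rfl⟩ := (IsAlgClosed.splits q).dvd_of_roots_le_roots hq hle
  have hs : s ≠ 0 := right_ne_zero_of_mul hr
  rw [natDegree_mul hq hs] at hdeg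
  rw [eq_C_of_natDegree_eq_zero (show s.natDegree = 0 by omega)]
  simp only [leadingCoeff_mul, leadingCoeff_C, C_mul]
  ring

/-- If all fibres over `ℂˣ` are nondegenerate, comparing coefficients of the fibres over `1` and
over `exp z` shows that `f_j` is zero or a monomial, with exponent affine in `j`. -/
theorem exists_isQuasiHomogeneousOfType (hf : ∀ x : ℂ, x ≠ 0 → f.IsNondegenerateAt x) :
    ∃ w α β : ℤ, f.IsQuasiHomogeneousOfType w α β ∧ α ≠ 0 := by
  set n := f.natDegree with hn
  obtain ⟨k, c, hc, hlead⟩ := isNonzeroMonomial_iff_eval_ne_zero.mpr fun x hx ↦ (hf x hx).1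
  obtain ⟨l, d, hd, hconst⟩ := isNonzeroMonomial_iff_eval_ne_zero.mpr fun x hx ↦ (hf x hx).2.1
  rw [← hn] at hlead
  obtain ⟨a, ha⟩ := exists_forall_root_exp hf
  have h1 := hf 1 one_ne_zero
  have hcoeff (j : ℕ) (hj : j ≤ n) (z : ℂ) : (f.coeff j).eval (Complex.exp z) =
      (f.coeff j).eval 1 * Complex.exp ((k + a * (n - j)) * z) := by
    have hz := hf _ (Complex.exp_ne_zero z)
    have hdeg : (f.fiber (Complex.exp z)).natDegree = n := natDegree_fiber hz.1
    have hdeg1 : (f.fiber 1).natDegree = n := natDegree_fiber h1.1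
    have hz0 : f.fiber (Complex.exp z) ≠ 0 := by
      intro h0
      have := hz.1
      rw [← coeff_fiber, h0, coeff_zero] at this
      exact this rfl
    -- the roots `b * exp (a * z)` of the fibre over `exp z` are scaled back to those over `1`
    have hprop := proportional_of_separable (q := f.fiber 1)
      (r := (f.fiber (Complex.exp z)).scaleRoots (Complex.exp (-(a * z))))
      (by rw [natDegree_scaleRoots, hdeg, hdeg1]) (separable_of_simple_roots h1.2.2)
      (scaleRoots_ne_zero hz0 _) fun b hb ↦ by
        have hb' : b = Complex.exp (-(a * z)) * (b * Complex.exp (a * z)) := by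
          rw [mul_left_comm, ← Complex.exp_add]
          simp
        rw [hb', scaleRoots_eval_mul, ha z b hb, mul_zero]
    have hj' := congrArg (coeff · j) hprop
    simp only [coeff_C_mul, leadingCoeff_scaleRoots, coeff_scaleRoots, coeff_fiber, hdeg] at hj'
    simp only [leadingCoeff, hdeg, hdeg1, coeff_fiber, hlead, eval_monomial, one_pow,
      mul_one, mul_assoc] at hj'
    replace hj' := mul_left_cancel₀ hc hj'
    have hE : Complex.exp ((k + a * (n - j)) * z) =
        Complex.exp z ^ k * Complex.exp (a * z) ^ (n - j) := by
      rw [← Complex.exp_nat_mul, ← Complex.exp_nat_mul, ← Complex.exp_add, Nat.cast_sub hj]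
      congr 1
      ring
    have hE' : Complex.exp (-(a * z)) ^ (n - j) * Complex.exp (a * z) ^ (n - j) = 1 := by
      rw [← mul_pow, ← Complex.exp_add]
      simp
    rw [hE]
    linear_combination Complex.exp (a * z) ^ (n - j) * (-hj') -
      (f.coeff j).eval (Complex.exp z) * hE'
  have hexp (i j : ℕ) (hij : (f.coeff j).coeff i ≠ 0) : j ≤ n ∧ (i : ℂ) = k + a * (n - j) := by
    have hj : j ≤ n := le_natDegree_of_ne_zero fun h ↦ hij (by rw [h, coeff_zero])
    exact ⟨hj, natCast_eq_of_eval_exp_eq (hcoeff j hj) hij⟩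
  have hl := (hexp l 0 (by rw [hconst]; simpa using hd)).2
  rw [Nat.cast_zero, sub_zero] at hl
  rcases Nat.eq_zero_or_pos n with hn0 | hn0
  · refine ⟨k, 1, 0, ⟨Or.inl one_ne_zero, fun i j hij ↦ ?_⟩, one_ne_zero⟩
    obtain ⟨hj, h⟩ := hexp i j hij
    obtain rfl : j = 0 := by omega
    rw [hn0] at h
    have h' : i = k := by
      apply Nat.cast_injective (R := ℂ)
      simpa using h
    simp [h']
  · -- eliminating `a` from `l = k + a n` and `i = k + a (n - j)` gives `n i + (l - k) j = n l`
    refine ⟨n * l, n, l - k, ⟨Or.inl (by exact_mod_cast hn0.ne'), fun i j hij ↦ ?_⟩,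
      by exact_mod_cast hn0.ne'⟩
    obtain ⟨-, h⟩ := hexp i j hij
    have h' : ((n * l : ℤ) : ℂ) = ((n * i + (l - k) * j : ℤ) : ℂ) := by
      push_cast
      linear_combination (n - j : ℂ) * hl - n * h
    exact_mod_cast h'

end BivariatePoly

theorem theorem1p2 (f : BivariatePoly)
    (hf_zero : f.coeff 0 ≠ 0) (hf_top : f.coeff f.yDegree ≠ 0) (hf_red : Squarefree f) :
    List.TFAE [
      ∃ w α β : ℤ, f.IsQuasiHomogeneousOfType w α β ∧ α ≠ 0,
      IsNonzeroMonomial (f.coeff 0) ∧ IsNonzeroMonomial (f.coeff f.yDegree) ∧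
        IsNonzeroMonomial f.discY,
      ProjLine.zeroLocus f.multiHomogenization ∩
          ProjLine.zeroLocus
            (MvPolynomial.X 2 * MvPolynomial.pderiv 2 f.multiHomogenization) ∩
          ProjLine.puncturedLine ×ˢ Set.univ = ∅] := by
  have h13 : (∃ w α β : ℤ, f.IsQuasiHomogeneousOfType w α β ∧ α ≠ 0) ↔
      ∀ a : ℂ, a ≠ 0 → f.IsNondegenerateAt a :=
    ⟨fun ⟨w, α, β, hf, hα⟩ a ha ↦ hf.isNondegenerateAt_of_squarefree hα hf_red hf_zero ha,
      BivariatePoly.exists_isQuasiHomogeneousOfType⟩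
  have h23 : (IsNonzeroMonomial (f.coeff 0) ∧ IsNonzeroMonomial (f.coeff f.yDegree) ∧
      IsNonzeroMonomial f.discY) ↔ ∀ a : ℂ, a ≠ 0 → f.IsNondegenerateAt a := by
    simp only [isNonzeroMonomial_iff_eval_ne_zero, BivariatePoly.isNondegenerateAt_iff,
      forall_and, BivariatePoly.yDegree]
  rw [BivariatePoly.zeroLocus_inter_eq_empty_iff]
  tfae_have 1 ↔ 3 := h13
  tfae_have 2 ↔ 3 := h23
  tfae_finish
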